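/- Let $d$ be a probability law on $\{0,1,2,\dots\}\cup\{\infty\}$ and let $H(s)=\sum_{k<\infty}d(\{k\})\,s^k$ be its generating function. Assume that $H(0)=0$ and that $H$ is strictly convex on $[0,1)$ (i.e. if $N$ has law $d$, then $\mathbb P(N=0)=0$ and $\mathbb P(2\le N<\infty)>0$). Fix an integer $n\ge 2$, and let $H_n(s)=\mathbb E\big[s^{\min(n,N)}\big]$ be the generating function of $N^n=\min(n,N)$. There is exactly one probability measure on $\{0,1\}$ that is invariant for the recursive distributional equation $X=1-\prod_{i=1}^{N^n}X_i$, that is, such that if $X_1,X_2,\dots$ are i.i.d. with this law and independent of $N^n$, then $1-\prod_{i=1}^{N^n}X_i$ has the same law. Let $\mu^1_n$ denote the mass it gives to $1$. Let $\mathbf T=\bigcup_{m\ge0}\mathbb N^m$ be the tree with infinite branching, with root $\emptyset$, let $ui$ be the $i$-th daughter of a vertex $u$ and $|u|$ the generation of $u$. Let $(N_u)_{u\in\mathbf T}$ be i.i.d. with law $d$, and put $N^n_u=\min(n,N_u)$. Let $(X_u)_{u\in\mathbf T}$ be a tree-indexed solution, with values in $[0,1]$, that corresponds to this invariant measure, i.e.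 1. for every $m$, the variables $(X_u;|u|=m)$ are mutually independent and, jointly, independent of $(N^n_v;|v|\le m-1)$; 2. for every $u$, $X_u=1-\prod_{i=1}^{N^n_u}X_{ui}$ almost surely; 3. every $X_u$ has the invariant law on $\{0,1\}$ above; in particular $\mathbb P(X_u=1)=\mu^1_n$. Then $(X_u)_{u\in\mathbf T}$ is endogenous, i.e. each $X_u$ is, up to null sets, measurable with respect to $\sigma(N^n_v; v\in\mathbf T)$, if and only if $H_n'(\mu^1_n)\le 1$. -/

import Mathlib

open MeasureTheory ProbabilityTheory
open scoped unitInterval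

noncomputable section

namespace VetoVoter

/-- The vertices of the tree with infinite branching: finite words in `ℕ`. The root is `[]`, the
daughters of `u` are `u ++ [0], u ++ [1], …`, and the generation of `u` is `u.length`. -/
abbrev Vertex : Type := List ℕ

/-- The product `x₀ x₁ ⋯` of the first `k` terms of a sequence in `[0,1]`, where `k = ∞` is allowed
(every such infinite product converges). -/
def liveProd (k : ℕ∞) (x : ℕ → I) : I := ∏' i : ℕ, if (i : ℕ∞) < k then x i else 1

theorem multipliable_unitInterval (x : ℕ → I) : Multipliable x := by
  refine ⟨⨅ s : Finset ℕ, ∏ i ∈ s, x i, ?_⟩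
  refine tendsto_atTop_iInf (fun s t hst => ?_)
  exact Finset.prod_le_prod_of_subset_of_le_one' hst (fun i _ _ => le_top)

theorem measurable_liveProd : Measurable (fun p : ℕ∞ × (ℕ → I) => liveProd p.1 p.2) := by
  have h : ∀ i : ℕ, Measurable
      (fun p : ℕ∞ × (ℕ → I) => if (i : ℕ∞) < p.1 then p.2 i else 1) := fun i =>
    Measurable.ite (measurable_fst (MeasurableSet.of_discrete (s := Set.Ioi (i : ℕ∞))))
      ((measurable_pi_apply i).comp measurable_snd) measurable_const
  refine measurable_of_tendsto_metrizable
    (f := fun m p => ∏ i ∈ Finset.range m, if (i : ℕ∞) < p.1 then p.2 i else 1)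
    (fun m => Finset.measurable_fun_prod _ (fun i _ => h i)) ?_
  exact tendsto_pi_nhds.2 fun p => (multipliable_unitInterval _).hasProd.tendsto_prod_nat

/-- The generating function `s ↦ ∑_{k < ∞} d(k) s ^ k` of a law `d` on `{0, 1, 2, …, ∞}`. -/
def pgf (d : Measure ℕ∞) (s : ℝ) : ℝ := ∑' k : ℕ, d.real {(k : ℕ∞)} * s ^ k

/-- The law of `min (n, N)` when `N` has law `d`. -/
def truncLaw (n : ℕ) (d : Measure ℕ∞) : Measure ℕ∞ := d.map (fun k => min (n : ℕ∞) k)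

/-- The map on laws on `[0,1]` associated with the equation `X = 1 - ∏_{i=1}^N X_i`: it sends `ν` to
the law of the right-hand side when `N` has law `d` and the `X_i` are i.i.d. with law `ν`,
independent of `N`. Here `σ` is `x ↦ 1 - x` on `[0,1]`. -/
def rdeMap (d : Measure ℕ∞) (ν : Measure I) [IsProbabilityMeasure ν] : Measure I :=
  (d.prod (Measure.infinitePi fun _ : ℕ => ν)).map (fun p => σ (liveProd p.1 p.2))

/-- `ν` is a probability measure on `{0,1}` that is invariant for `X = 1 - ∏_{i=1}^N X_i`, where
`N` has law `d`. -/
structure IsDiscreteInvariant (d : Measure ℕ∞) (ν : Measure I) : Prop where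
  isProb : IsProbabilityMeasure ν
  discrete : ∀ᵐ x ∂ν, x = 0 ∨ x = 1
  invariant : rdeMap d ν = ν

/-- The family sizes `(N u)` are i.i.d. random variables with law `d`. -/
structure IsNoise {Ω : Type*} [MeasurableSpace Ω] (P : Measure Ω) (d : Measure ℕ∞)
    (N : Vertex → Ω → ℕ∞) : Prop where
  measurable : ∀ u, Measurable (N u)
  indep : iIndepFun N P
  law : ∀ u, P.map (N u) = d

/-- `X` is a tree-indexed solution of the equation with family sizes `N`. -/
structure IsTreeSolution {Ω : Type*} [MeasurableSpace Ω] (P : Measure Ω)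
    (N : Vertex → Ω → ℕ∞) (X : Vertex → Ω → I) : Prop where
  measurable : ∀ u, Measurable (X u)
  /-- the values in each generation are mutually independent -/
  indep_level : ∀ m : ℕ, iIndepFun (fun u : {u : Vertex // u.length = m} => X u) P
  /-- they are jointly independent of the family sizes in all earlier generations -/
  indep_noise : ∀ m : ℕ, IndepFun (fun ω (u : {u : Vertex // u.length = m}) => X u ω)
    (fun ω (v : {v : Vertex // v.length < m}) => N v ω) P
  equation : ∀ u, ∀ᵐ ω ∂P, X u ω = σ (liveProd (N u ω) (fun i => X (u ++ [i]) ω))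
  stationary : ∀ u, P.map (X u) = P.map (X [])

/-- `X` is endogenous: up to null sets it is measurable with respect to the sigma-algebra generated
by all the family sizes. -/
def IsEndogenous {Ω : Type*} [MeasurableSpace Ω] (P : Measure Ω)
    (N : Vertex → Ω → ℕ∞) (X : Vertex → Ω → I) : Prop :=
  ∀ u, ∃ Y : Ω → I, Measurable[⨆ v, MeasurableSpace.comap (N v) inferInstance] Y ∧ X u =ᵐ[P] Y

end VetoVoter

end

namespace VetoVoter

open Filter Topology

/-! Write `H` for the generating function of the truncated law and `p` for the mass at `1`. A law on
`{0,1}` is determined by its mean, so invariance amounts to `p + H p = 1`, which has exactly one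
root in `[0,1]` (`existsUnique_isDiscreteInvariant`).

The conditional mean of `X u` given the family sizes in generations below `|u| + m` is obtained by
putting `p` at every vertex of generation `|u| + m` and iterating the equation down to `u`
(`condExp_treeSolution`). Its second moment `r m` satisfies `r 0 = p ^ 2` and `r (m + 1) = 1 - 2 * H
p + H (r m) = 2 * p - 1 + H (r m)` (`moments_treeIter`). By Lévy's upward theorem `r m` converges to
the second moment of the conditional mean given all family sizes (`tendsto_secondMoment_condExp`).

Since `X u` is `{0,1}`-valued, its own second moment is `p`, and it is endogenous exactly when
conditioning loses no second moment, that is, when `r m → p`. Now `p` is a fixed point of `r ↦ 2 * p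
- 1 + H r`, with slope `H' p`. If the slope is at most `1`, strict convexity excludes a smaller
fixed point and `r m` increases to `p` (`tendsto_secondMoment`); if it exceeds `1`, `r m` is trapped
strictly below `p` (`exists_secondMoment_le`). -/

/-! ### Products of bounded random length and their means -/

theorem coe_prod_unitInterval {ι : Type*} (s : Finset ι) (x : ι → I) :
    ((∏ i ∈ s, x i : I) : ℝ) = ∏ i ∈ s, (x i : ℝ) := by
  classical
  induction s using Finset.induction_on with
  | empty => simp
  | insert a s ha ih => rw [Finset.prod_insert ha, Finset.prod_insert ha, ← ih]; rfl

theorem liveProd_natCast (k : ℕ) (x : ℕ → I) :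
    liveProd k x = ∏ i ∈ Finset.range k, x i := by
  unfold liveProd
  rw [tprod_eq_prod (s := Finset.range k)]
  · refine Finset.prod_congr rfl fun i hi => ?_
    rw [if_pos (by exact_mod_cast Finset.mem_range.1 hi)]
  · intro i hi
    rw [if_neg (by simpa using hi)]

theorem liveProd_mul_natCast (k : ℕ) (x y : ℕ → I) :
    liveProd k x * liveProd k y = liveProd k (fun i => x i * y i) := by
  simp only [liveProd_natCast, Finset.prod_mul_distrib]

theorem exists_natCast_eq_of_le {n : ℕ} {k : ℕ∞} (h : k ≤ n) : ∃ j ≤ n, k = (j : ℕ∞) := by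
  lift k to ℕ using ne_top_of_le_ne_top (ENat.natCast_ne_top n) h
  exact ⟨k, by exact_mod_cast h, rfl⟩

theorem liveProd_mul {n : ℕ} {k : ℕ∞} (h : k ≤ n) (x y : ℕ → I) :
    liveProd k x * liveProd k y = liveProd k (fun i => x i * y i) := by
  obtain ⟨j, -, rfl⟩ := exists_natCast_eq_of_le h
  exact liveProd_mul_natCast j x y

/-- Separates the number of factors from the factors, so that expectations of each summand split by
independence. -/
theorem liveProd_eq_sum {n : ℕ} {k : ℕ∞} (h : k ≤ n) (x : ℕ → I) :
    (liveProd k x : ℝ) = ∑ j ∈ Finset.range (n + 1),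
      (if k = (j : ℕ∞) then 1 else 0) * ∏ i ∈ Finset.range j, (x i : ℝ) := by
  obtain ⟨j, hj, rfl⟩ := exists_natCast_eq_of_le h
  rw [liveProd_natCast, coe_prod_unitInterval]
  simp only [ENat.natCast_inj, ite_mul, one_mul, zero_mul]
  rw [Finset.sum_ite_eq, if_pos (Finset.mem_range.2 (by omega))]

theorem measurable_liveProd_comp {Ω : Type*} [MeasurableSpace Ω] {K : Ω → ℕ∞} {Z : ℕ → Ω → I}
    (hK : Measurable K) (hZ : ∀ i, Measurable (Z i)) :
    Measurable (fun ω => liveProd (K ω) (fun i => Z i ω)) :=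
  measurable_liveProd.comp (hK.prodMk (measurable_pi_lambda _ hZ))

theorem integrable_coe_unitInterval {Ω : Type*} [MeasurableSpace Ω] {P : Measure Ω}
    [IsFiniteMeasure P] {Z : Ω → I} (hZ : Measurable Z) : Integrable (fun ω => (Z ω : ℝ)) P := by
  refine Integrable.of_bound (C := 1) (by fun_prop) (ae_of_all _ fun ω => ?_)
  rw [Real.norm_of_nonneg (Z ω).2.1]
  exact (Z ω).2.2

/-- The mean of a product of independent variables is the product of the means. -/
theorem integral_prod_of_iIndepFun {Ω ι : Type*} [MeasurableSpace Ω] {P : Measure Ω}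
    {Z : ι → Ω → ℝ} (hZ : iIndepFun Z P) (hm : ∀ i, Measurable (Z i)) (s : Finset ι) :
    ∫ ω, ∏ i ∈ s, Z i ω ∂P = ∏ i ∈ s, ∫ ω, Z i ω ∂P := by
  have h := (hZ.precomp (g := ((↑) : s → ι)) Subtype.val_injective).integral_fun_prod_eq_prod_integral
    (fun i => (hm i).aestronglyMeasurable)
  simpa only [Finset.prod_coe_sort s (fun i => ∫ ω, Z i ω ∂P),
    fun ω => Finset.prod_coe_sort s (fun i => Z i ω)] using h

/-- The mean of `liveProd K Z` for i.i.d. `Z` independent of the bounded variable `K`. -/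
theorem integral_liveProd {Ω : Type*} [MeasurableSpace Ω] {P : Measure Ω} [IsProbabilityMeasure P]
    {n : ℕ} {K : Ω → ℕ∞} {Z : ℕ → Ω → I} (hK : Measurable K) (hKn : ∀ᵐ ω ∂P, K ω ≤ n)
    (hZ : ∀ i, Measurable (Z i)) (hi : iIndepFun Z P) (hKZ : IndepFun K (fun ω i => Z i ω) P)
    {z : ℝ} (hz : ∀ i, ∫ ω, (Z i ω : ℝ) ∂P = z) :
    ∫ ω, (liveProd (K ω) (fun i => Z i ω) : ℝ) ∂P =
      ∑ j ∈ Finset.range (n + 1), (P.map K).real {(j : ℕ∞)} * z ^ j := by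
  classical
  have hprod : ∀ j, Measurable fun y : ℕ → I => ∏ i ∈ Finset.range j, (y i : ℝ) := fun j =>
    Finset.measurable_fun_prod _ fun i _ => (measurable_pi_apply i).subtype_val
  have hind : ∀ j : ℕ, Measurable fun k : ℕ∞ => if k = (j : ℕ∞) then (1 : ℝ) else 0 :=
    fun j => measurable_of_countable _
  have e : (fun ω => (liveProd (K ω) (fun i => Z i ω) : ℝ)) =ᵐ[P] fun ω =>
      ∑ j ∈ Finset.range (n + 1), (if K ω = (j : ℕ∞) then 1 else 0) *
        ∏ i ∈ Finset.range j, (Z i ω : ℝ) := by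
    filter_upwards [hKn] with ω hω using liveProd_eq_sum hω _
  rw [integral_congr_ae e, integral_finsetSum]
  · refine Finset.sum_congr rfl fun j _ => ?_
    rw [hKZ.integral_fun_comp_mul_comp (f := fun k : ℕ∞ => if k = (j : ℕ∞) then (1 : ℝ) else 0)
      (g := fun y : ℕ → I => ∏ i ∈ Finset.range j, (y i : ℝ)) hK.aemeasurable
      (measurable_pi_lambda _ hZ).aemeasurable (hind j).aestronglyMeasurable
      (hprod j).aestronglyMeasurable]
    congr 1
    · rw [map_measureReal_apply hK (.singleton _),
        ← integral_indicator_one (hK (.singleton (j : ℕ∞)))]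
      simp [Set.indicator_apply]
    · rw [integral_prod_of_iIndepFun (Z := fun i ω => (Z i ω : ℝ))
        (hi.comp (fun _ => Subtype.val) fun _ => measurable_subtype_coe)
        (fun i => (hZ i).subtype_val)]
      simp [hz]
  · intro j _
    refine Integrable.of_bound (C := 1) ?_ (ae_of_all _ fun ω => ?_)
    · exact (((hind j).comp hK).mul
        ((hprod j).comp (measurable_pi_lambda _ hZ))).aestronglyMeasurable
    · rw [← coe_prod_unitInterval]
      split_ifs <;> simp [abs_of_nonneg (unitInterval.nonneg _), unitInterval.le_one]

/-- Sigma-algebras generated by disjoint blocks of an independent family are independent. -/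
theorem iIndep_iSup_of_disjoint {Ω ι κ : Type*} {mΩ : MeasurableSpace Ω} {P : Measure Ω}
    {m : ι → MeasurableSpace Ω} (hle : ∀ i, m i ≤ mΩ) (h : iIndep m P) {S : κ → Set ι}
    (hS : Pairwise fun a b => Disjoint (S a) (S b)) : iIndep (fun a => ⨆ i ∈ S a, m i) P := by
  classical
  have := h.isProbabilityMeasure
  rw [iIndep_iff]
  intro s f hf
  induction s using Finset.induction_on with
  | empty => simp
  | insert a s ha ih =>
    have hdisj : Disjoint (S a) (⋃ b ∈ s, S b) := by
      rw [Set.disjoint_iUnion₂_right]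
      exact fun b hb => hS (fun e => ha (e ▸ hb))
    have hI := (Indep_iff _ _ _).1 (indep_iSup_of_disjoint hle h hdisj)
    rw [Finset.set_biInter_insert, Finset.prod_insert ha,
      hI _ _ (hf a (Finset.mem_insert_self a s)), ih fun b hb => hf b (Finset.mem_insert_of_mem hb)]
    refine Finset.measurableSet_biInter s fun b hb => ?_
    refine (?_ : (⨆ i ∈ S b, m i) ≤ ⨆ i ∈ ⋃ b ∈ s, S b, m i) _
      (hf b (Finset.mem_insert_of_mem hb))
    exact biSup_mono fun i hi => Set.mem_biUnion hb hi

/-! ### The generating function of the truncated law -/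

theorem pgf_eq_sum {d : Measure ℕ∞} {n : ℕ} (hd : ∀ᵐ k ∂d, k ≤ (n : ℕ∞)) (s : ℝ) :
    pgf d s = ∑ k ∈ Finset.range (n + 1), d.real {(k : ℕ∞)} * s ^ k := by
  refine tsum_eq_sum fun k hk => ?_
  have : d {(k : ℕ∞)} = 0 := by
    refine measure_mono_null (fun x hx => ?_) hd
    rw [Set.mem_singleton_iff.1 hx]
    simpa using hk
  simp [measureReal_def, this]

theorem ae_truncLaw_le (n : ℕ) (d : Measure ℕ∞) : ∀ᵐ k ∂truncLaw n d, k ≤ (n : ℕ∞) := by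
  unfold truncLaw
  rw [ae_map_iff (by fun_prop) (Set.to_countable _).measurableSet]
  exact ae_of_all _ fun k => min_le_left _ _

instance isProbabilityMeasure_truncLaw (n : ℕ) (d : Measure ℕ∞) [IsProbabilityMeasure d] :
    IsProbabilityMeasure (truncLaw n d) :=
  Measure.isProbabilityMeasure_map (by fun_prop)

/-- Truncation moves any mass of `d` at `∞` to `n`, so no mass is missing from the sum. -/
theorem pgf_truncLaw_one (n : ℕ) (d : Measure ℕ∞) [IsProbabilityMeasure d] :
    pgf (truncLaw n d) 1 = 1 := by
  classical
  rw [pgf_eq_sum (ae_truncLaw_le n d)]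
  simp only [one_pow, mul_one]
  have h := sum_measureReal_singleton (μ := truncLaw n d)
    ((Finset.range (n + 1)).image ((↑) : ℕ → ℕ∞))
  rw [Finset.sum_image (by intro a _ b _ h; exact_mod_cast h)] at h
  rw [h, measureReal_def]
  refine (ENNReal.toReal_eq_one_iff _).2 ?_
  rw [prob_compl_eq_zero_iff (by measurability) |>.1]
  refine measure_mono_null (fun x hx => ?_) (ae_truncLaw_le n d)
  intro hxn
  lift x to ℕ using ne_top_of_le_ne_top (ENat.natCast_ne_top n) hxn
  exact hx (by simpa [Nat.lt_succ_iff] using hxn)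

theorem measure_zero_of_pgf {d : Measure ℕ∞} [IsProbabilityMeasure d] (h : pgf d 0 = 0) :
    d.real {0} = 0 := by
  unfold pgf at h
  rw [tsum_eq_single 0 (by intro k hk; simp [hk])] at h
  simpa using h

theorem truncLaw_real_zero {d : Measure ℕ∞} [IsProbabilityMeasure d] (h : pgf d 0 = 0) {n : ℕ}
    (hn : 0 < n) : (truncLaw n d).real {0} = 0 := by
  rw [truncLaw, map_measureReal_apply (by fun_prop) (.singleton _), ← measure_zero_of_pgf h]
  congr 1
  ext k
  simp only [Set.mem_preimage, Set.mem_singleton_iff, min_eq_iff, Nat.cast_eq_zero, hn.ne',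
    false_and, false_or, and_iff_left_iff_imp]
  rintro rfl
  exact zero_le

theorem pgf_truncLaw_zero {d : Measure ℕ∞} [IsProbabilityMeasure d] (h : pgf d 0 = 0) {n : ℕ}
    (hn : 0 < n) : pgf (truncLaw n d) 0 = 0 := by
  rw [pgf_eq_sum (ae_truncLaw_le n d)]
  refine Finset.sum_eq_zero fun k _ => ?_
  rcases eq_or_ne k 0 with rfl | hk
  · simpa using truncLaw_real_zero h hn
  · simp [hk]

/-- Otherwise the generating function would be affine, which contradicts strict convexity already at
the midpoint of `0` and `1/2`. -/
theorem exists_two_le_measure_pos {d : Measure ℕ∞}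
    (hd : StrictConvexOn ℝ (Set.Ico (0 : ℝ) 1) (pgf d)) :
    ∃ k : ℕ, 2 ≤ k ∧ 0 < d.real {(k : ℕ∞)} := by
  by_contra! hcon
  have h0 : ∀ k : ℕ, 2 ≤ k → d.real {(k : ℕ∞)} = 0 := fun k hk =>
    le_antisymm (hcon k hk) measureReal_nonneg
  have hlin : ∀ s, pgf d s = d.real {((0 : ℕ) : ℕ∞)} + d.real {((1 : ℕ) : ℕ∞)} * s := by
    intro s
    unfold pgf
    rw [tsum_eq_sum (s := Finset.range 2)]
    · simp [Finset.sum_range_succ]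
    · intro k hk
      rw [h0 k (by simp at hk; omega), zero_mul]
  have h := hd.2 (show (0 : ℝ) ∈ Set.Ico (0 : ℝ) 1 by norm_num)
    (show (1 / 2 : ℝ) ∈ Set.Ico (0 : ℝ) 1 by norm_num)
    (by norm_num) (show (0 : ℝ) < 1 / 2 by norm_num) (show (0 : ℝ) < 1 / 2 by norm_num)
    (by norm_num)
  simp only [hlin, smul_eq_mul] at h
  linarith

theorem exists_two_le_truncLaw_pos {d : Measure ℕ∞} [IsProbabilityMeasure d]
    (hd : StrictConvexOn ℝ (Set.Ico (0 : ℝ) 1) (pgf d)) {n : ℕ} (hn : 2 ≤ n) :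
    ∃ k : ℕ, k ∈ Finset.range (n + 1) ∧ 2 ≤ k ∧ 0 < (truncLaw n d).real {(k : ℕ∞)} := by
  obtain ⟨k, hk, hpos⟩ := exists_two_le_measure_pos hd
  refine ⟨min n k, by simp, by omega, hpos.trans_le ?_⟩
  rw [truncLaw, map_measureReal_apply (by fun_prop) (.singleton _)]
  exact measureReal_mono (by rintro _ rfl; exact (Nat.mono_cast.map_min).symm)

/-- The truncated generating function is a polynomial with nonnegative coefficients, hence convex on
the whole half-line; one monomial of degree at least `2` with positive weight makes it strictly so.
-/
theorem strictConvexOn_pgf_truncLaw {d : Measure ℕ∞} [IsProbabilityMeasure d]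
    (hd : StrictConvexOn ℝ (Set.Ico (0 : ℝ) 1) (pgf d)) {n : ℕ} (hn : 2 ≤ n) :
    StrictConvexOn ℝ (Set.Ici 0) (pgf (truncLaw n d)) := by
  classical
  obtain ⟨k, hkn, hk, hpos⟩ := exists_two_le_truncLaw_pos hd hn
  have e : pgf (truncLaw n d) = fun s => (∑ j ∈ (Finset.range (n + 1)).erase k,
      (truncLaw n d).real {(j : ℕ∞)} * s ^ j) + (truncLaw n d).real {(k : ℕ∞)} * s ^ k := by
    ext s
    rw [pgf_eq_sum (ae_truncLaw_le n d), Finset.sum_erase_add _ _ hkn]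
  rw [e]
  refine ConvexOn.add_strictConvexOn ?_ ?_
  · have h : ∀ t : Finset ℕ, ConvexOn ℝ (Set.Ici (0 : ℝ))
        (fun s => ∑ j ∈ t, (truncLaw n d).real {(j : ℕ∞)} * s ^ j) := by
      intro t
      induction t using Finset.induction_on with
      | empty => simpa using convexOn_const (0 : ℝ) (convex_Ici 0)
      | insert a t ha ih =>
        simp only [Finset.sum_insert ha]
        exact ((convexOn_pow a).smul measureReal_nonneg).add ih
    exact h _
  · refine ⟨convex_Ici 0, fun x hx y hy hxy a b ha hb hab => ?_⟩
    have := (strictConvexOn_pow hk).2 hx hy hxy ha hb hab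
    simp only [smul_eq_mul] at this ⊢
    nlinarith

theorem hasDerivAt_pgf_truncLaw (n : ℕ) (d : Measure ℕ∞) (s : ℝ) :
    HasDerivAt (pgf (truncLaw n d)) (deriv (pgf (truncLaw n d)) s) s := by
  have e : pgf (truncLaw n d) = fun s => ∑ j ∈ Finset.range (n + 1),
      (truncLaw n d).real {(j : ℕ∞)} * s ^ j :=
    funext fun s => pgf_eq_sum (ae_truncLaw_le n d) s
  rw [e]
  exact DifferentiableAt.hasDerivAt (by fun_prop)

theorem monotoneOn_pgf_truncLaw (n : ℕ) (d : Measure ℕ∞) :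
    MonotoneOn (pgf (truncLaw n d)) (Set.Ici 0) := by
  intro x hx y _ hxy
  rw [pgf_eq_sum (ae_truncLaw_le n d), pgf_eq_sum (ae_truncLaw_le n d)]
  refine Finset.sum_le_sum fun j _ => mul_le_mul_of_nonneg_left ?_ measureReal_nonneg
  exact pow_le_pow_left₀ hx hxy j

/-! ### The scalar recursion for the second moments -/

/-- The second moments of the successive conditional probabilities of a fixed point `p`. -/
noncomputable def secondMoment (H : ℝ → ℝ) (p : ℝ) : ℕ → ℝ
  | 0 => p ^ 2
  | m + 1 => 2 * p - 1 + H (secondMoment H p m)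

/-- Chords ending at `p` have slope less than `H' p ≤ 1`, so `r ↦ 2 * p - 1 + H r` lies strictly
above the diagonal on `[0, p)`. The iterates increase, stay below `p`, and can only converge to a
fixed point. -/
theorem tendsto_secondMoment {H : ℝ → ℝ} {p : ℝ} (hp : p ∈ Set.Ioo (0 : ℝ) 1)
    (hH : StrictConvexOn ℝ (Set.Ici 0) H) (hmono : MonotoneOn H (Set.Ici 0))
    (hdiff : ∀ s, HasDerivAt H (deriv H s) s) (hfix : p + H p = 1) (hder : deriv H p ≤ 1) :
    Tendsto (secondMoment H p) atTop (𝓝 p) := by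
  have hlt : ∀ r, 0 ≤ r → r < p → r < 2 * p - 1 + H r := by
    intro r hr hrp
    have h := hH.slope_lt_of_hasDerivAt hr hp.1.le hrp (hdiff p)
    rw [slope_def_field, div_lt_iff₀ (by linarith)] at h
    nlinarith
  have hbd : ∀ m, secondMoment H p m ∈ Set.Icc 0 p := by
    intro m
    induction m with
    | zero => exact ⟨sq_nonneg p, by simp only [secondMoment]; nlinarith [hp.1, hp.2]⟩
    | succ m ih =>
      have h1 := hmono ih.1 (hp.1.le : p ∈ Set.Ici 0) ih.2
      simp only [secondMoment]
      refine ⟨?_, by linarith⟩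
      rcases ih.2.lt_or_eq with h | h
      · exact (ih.1.trans_lt (hlt _ ih.1 h)).le
      · rw [h]; linarith [hp.1]
  have hmon : Monotone (secondMoment H p) := by
    refine monotone_nat_of_le_succ fun m => ?_
    rcases (hbd m).2.lt_or_eq with h | h
    · exact (hlt _ (hbd m).1 h).le
    · simp only [secondMoment, h]; linarith
  obtain ⟨l, hl⟩ : ∃ l, Tendsto (secondMoment H p) atTop (𝓝 l) :=
    ⟨_, tendsto_atTop_ciSup hmon ⟨p, by rintro _ ⟨m, rfl⟩; exact (hbd m).2⟩⟩
  have hlm : l ∈ Set.Icc 0 p := isClosed_Icc.mem_of_tendsto hl (Eventually.of_forall hbd)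
  have hl' : Tendsto (fun m => secondMoment H p (m + 1)) atTop (𝓝 (2 * p - 1 + H l)) :=
    (((hdiff l).continuousAt.tendsto).comp hl).const_add _
  have heq := tendsto_nhds_unique hl' ((tendsto_add_atTop_iff_nat 1).2 hl)
  rcases hlm.2.lt_or_eq with h | h
  · exact absurd heq (hlt l hlm.1 h).ne'
  · rwa [h] at hl

/-- With slope above `1` at `p`, the map `r ↦ 2 * p - 1 + H r` is below the diagonal just to the
left of `p`. Any such point `c` is a barrier by monotonicity, provided the recursion starts below
it. -/
theorem exists_secondMoment_le {H : ℝ → ℝ} {p : ℝ} (hp : p ∈ Set.Ioo (0 : ℝ) 1)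
    (hmono : MonotoneOn H (Set.Ici 0)) (hdiff : HasDerivAt H (deriv H p) p) (hfix : p + H p = 1)
    (hder : 1 < deriv H p) (hnn : ∀ m, 0 ≤ secondMoment H p m) :
    ∃ c < p, ∀ m, secondMoment H p m ≤ c := by
  have hsl := (hasDerivAt_iff_tendsto_slope_left_right.1 hdiff).1
  -- Leaves room to choose `c` between the starting value `p ^ 2` and `p`.
  have hpp : p ^ 2 < p := by nlinarith [hp.1, hp.2]
  obtain ⟨c, hc, hcp⟩ := ((hsl.eventually_const_lt hder).and
    (Ioo_mem_nhdsLT hpp : Set.Ioo (p ^ 2) p ∈ 𝓝[<] p)).exists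
  rw [slope_def_field, lt_div_iff_of_neg (by linarith [hcp.2])] at hc
  refine ⟨c, hcp.2, fun m => ?_⟩
  induction m with
  | zero => exact hcp.1.le
  | succ m ih =>
    have := hmono (hnn m) ((hnn m).trans ih : (0 : ℝ) ≤ c) ih
    simp only [secondMoment]
    linarith

/-! ### Invariant laws on `{0,1}` -/

theorem integral_eq_real_one {ν : Measure I} [IsProbabilityMeasure ν]
    (h : ∀ᵐ x ∂ν, x = 0 ∨ x = 1) : ∫ x, (x : ℝ) ∂ν = ν.real {1} := by
  rw [← integral_indicator_one (.singleton (1 : I))]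
  refine integral_congr_ae ?_
  filter_upwards [h] with x hx
  rcases hx with rfl | rfl <;> simp

theorem measure_eq_of_discrete {ν ρ : Measure I} [IsProbabilityMeasure ν] [IsProbabilityMeasure ρ]
    (hν : ∀ᵐ x ∂ν, x = 0 ∨ x = 1) (hρ : ∀ᵐ x ∂ρ, x = 0 ∨ x = 1) (h : ν.real {1} = ρ.real {1}) :
    ν = ρ := by
  have key : ∀ (τ : Measure I) [IsProbabilityMeasure τ], (∀ᵐ x ∂τ, x = 0 ∨ x = 1) →
      ∀ A : Set I, MeasurableSet A → τ.real A =
        A.indicator 1 0 * (1 - τ.real {1}) + A.indicator 1 1 * τ.real {1} := by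
    intro τ _ hτ A hA
    rw [← integral_eq_real_one hτ, ← integral_indicator_one hA]
    have hx : Integrable (fun x : I => (x : ℝ)) τ := integrable_coe_unitInterval measurable_id
    have h1 : (1 : ℝ) - ∫ x : I, (x : ℝ) ∂τ = ∫ x : I, (1 - (x : ℝ)) ∂τ := by
      rw [integral_sub (integrable_const _) hx]; simp
    have h2 : Integrable (fun x : I => 1 - (x : ℝ)) τ := (integrable_const _).sub hx
    rw [h1, ← integral_const_mul, ← integral_const_mul,
      ← integral_add (h2.const_mul _) (hx.const_mul _)]
    refine integral_congr_ae ?_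
    filter_upwards [hτ] with x hx
    rcases hx with rfl | rfl <;> simp
  ext A hA
  rw [← measureReal_eq_measureReal_iff, key ν hν A hA, key ρ hρ A hA, h]

theorem integral_rdeMap {d : Measure ℕ∞} [IsProbabilityMeasure d] {n : ℕ}
    (hd : ∀ᵐ k ∂d, k ≤ (n : ℕ∞)) (ν : Measure I) [IsProbabilityMeasure ν] :
    ∫ x, (x : ℝ) ∂rdeMap d ν = 1 - pgf d (∫ x, (x : ℝ) ∂ν) := by
  have hm : Measurable fun p : ℕ∞ × (ℕ → I) => (liveProd p.1 p.2 : I) := measurable_liveProd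
  have hev : ∀ i : ℕ, Measurable fun p : ℕ∞ × (ℕ → I) => p.2 i := fun i => by fun_prop
  have hlaw : ∀ i : ℕ, (d.prod (Measure.infinitePi fun _ : ℕ => ν)).map (fun p => p.2 i) = ν := by
    intro i
    rw [show (fun p : ℕ∞ × (ℕ → I) => p.2 i) = (fun x : ℕ → I => x i) ∘ Prod.snd from rfl,
      ← Measure.map_map (by fun_prop) (by fun_prop), Measure.map_snd_prod, measure_univ, one_smul]
    exact Measure.infinitePi_map_eval _ i
  rw [rdeMap, integral_map (by fun_prop) (by fun_prop)]
  simp only [unitInterval.coe_symm_eq]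
  rw [integral_sub (integrable_const _) (integrable_coe_unitInterval hm),
    integral_liveProd (n := n) (z := ∫ x, (x : ℝ) ∂ν) measurable_fst ?_ hev ?_ ?_ ?_,
    Measure.map_fst_prod, pgf_eq_sum hd]
  · simp
  · exact Measure.quasiMeasurePreserving_fst.ae hd
  · rw [iIndepFun_iff_map_fun_eq_infinitePi_map hev]
    simp only [hlaw]
    exact (Measure.map_snd_prod).trans (by simp)
  · exact indepFun_prod (X := id) (Y := id) measurable_id measurable_id
  · intro i
    conv_rhs => rw [← hlaw i]
    rw [integral_map (by fun_prop) (by fun_prop)]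

theorem isProbabilityMeasure_rdeMap (d : Measure ℕ∞) [IsProbabilityMeasure d] (ν : Measure I)
    [IsProbabilityMeasure ν] : IsProbabilityMeasure (rdeMap d ν) :=
  Measure.isProbabilityMeasure_map (by have := measurable_liveProd; fun_prop)

theorem prod_eq_zero_or_one {s : Finset ℕ} {x : ℕ → I} (h : ∀ i, x i = 0 ∨ x i = 1) :
    ∏ i ∈ s, x i = 0 ∨ ∏ i ∈ s, x i = 1 := by
  induction s using Finset.induction_on with
  | empty => simp
  | insert a s ha ih =>
    rw [Finset.prod_insert ha]
    rcases h a with h | h <;> simp [h, ih]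

theorem discrete_rdeMap {d : Measure ℕ∞} [IsProbabilityMeasure d] {n : ℕ}
    (hd : ∀ᵐ k ∂d, k ≤ (n : ℕ∞)) {ν : Measure I} [IsProbabilityMeasure ν]
    (h : ∀ᵐ x ∂ν, x = 0 ∨ x = 1) : ∀ᵐ x ∂rdeMap d ν, x = 0 ∨ x = 1 := by
  have hmeas := measurable_liveProd
  have hA : MeasurableSet {x : I | x = 0 ∨ x = 1} :=
    (MeasurableSet.singleton (0 : I)).union (.singleton 1)
  rw [rdeMap, ae_map_iff (by fun_prop) hA]
  have h1 : ∀ᵐ x ∂Measure.infinitePi fun _ : ℕ => ν, ∀ i, x i = 0 ∨ x i = 1 := by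
    rw [ae_all_iff]
    intro i
    exact (measurePreserving_eval_infinitePi (fun _ : ℕ => ν) i).quasiMeasurePreserving.ae h
  filter_upwards [Measure.quasiMeasurePreserving_fst.ae hd,
    Measure.quasiMeasurePreserving_snd.ae h1] with p hp1 hp2
  obtain ⟨j, -, hj⟩ := exists_natCast_eq_of_le hp1
  rw [hj, liveProd_natCast]
  rcases prod_eq_zero_or_one (s := Finset.range j) hp2 with h | h <;> simp [h]

/-- `rdeMap` preserves laws on `{0,1}`, and these are determined by their mean, so it is enough to
compare means. -/
theorem isDiscreteInvariant_iff {d : Measure ℕ∞} [IsProbabilityMeasure d] {n : ℕ}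
    (hd : ∀ᵐ k ∂d, k ≤ (n : ℕ∞)) {ν : Measure I} [hν : IsProbabilityMeasure ν]
    (h : ∀ᵐ x ∂ν, x = 0 ∨ x = 1) :
    IsDiscreteInvariant d ν ↔ ν.real {1} + pgf d (ν.real {1}) = 1 := by
  have := isProbabilityMeasure_rdeMap d ν
  have e := integral_rdeMap hd ν
  rw [integral_eq_real_one (discrete_rdeMap hd h), integral_eq_real_one h] at e
  constructor
  · intro hi
    rw [hi.invariant] at e
    linarith
  · intro hp
    exact ⟨hν, h, measure_eq_of_discrete (discrete_rdeMap hd h) h (by linarith)⟩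

theorem exists_discrete_measure {p : ℝ} (hp : p ∈ Set.Icc (0 : ℝ) 1) :
    ∃ ν : Measure I, IsProbabilityMeasure ν ∧ (∀ᵐ x ∂ν, x = 0 ∨ x = 1) ∧ ν.real {1} = p := by
  refine ⟨ENNReal.ofReal (1 - p) • Measure.dirac 0 + ENNReal.ofReal p • Measure.dirac 1,
    ⟨?_⟩, ?_, ?_⟩
  · simp [← ENNReal.ofReal_add (sub_nonneg.2 hp.2) hp.1]
  · rw [ae_add_measure_iff]
    exact ⟨Measure.ae_smul_measure (by simp [ae_dirac_eq]) _,
      Measure.ae_smul_measure (by simp [ae_dirac_eq]) _⟩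
  · simp [measureReal_def, hp.1]

theorem mem_Ioo_of_add_pgf_eq_one {d : Measure ℕ∞} [IsProbabilityMeasure d] (h0 : pgf d 0 = 0)
    {n : ℕ} (hn : 0 < n) {p : ℝ} (hp : p ∈ Set.Icc (0 : ℝ) 1)
    (h : p + pgf (truncLaw n d) p = 1) : p ∈ Set.Ioo (0 : ℝ) 1 := by
  constructor
  · refine hp.1.lt_of_ne ?_
    rintro rfl
    rw [pgf_truncLaw_zero h0 hn] at h
    norm_num at h
  · refine hp.2.lt_of_ne ?_
    rintro rfl
    rw [pgf_truncLaw_one] at h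
    norm_num at h

/-- The function `s ↦ s + H s` is continuous and strictly increasing from `0` to `2` on `[0,1]`, so
it takes the value `1` exactly once. -/
theorem existsUnique_isDiscreteInvariant {d : Measure ℕ∞} [IsProbabilityMeasure d]
    (h0 : pgf d 0 = 0) {n : ℕ} (hn : 0 < n) :
    ∃! ν : Measure I, IsDiscreteInvariant (truncLaw n d) ν := by
  have hle := ae_truncLaw_le n d
  have hcont : Continuous (pgf (truncLaw n d)) :=
    continuous_iff_continuousAt.2 fun s => (hasDerivAt_pgf_truncLaw n d s).continuousAt
  obtain ⟨p, hp, hpe⟩ : (1 : ℝ) ∈ (fun s => s + pgf (truncLaw n d) s) '' Set.Icc 0 1 := by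
    refine intermediate_value_Icc zero_le_one (by fun_prop) ?_
    simp [pgf_truncLaw_zero h0 hn, pgf_truncLaw_one]
  obtain ⟨ν, hν, hdisc, hmass⟩ := exists_discrete_measure hp
  refine ⟨ν, (isDiscreteInvariant_iff hle hdisc).2 (by rw [hmass]; exact hpe), fun ρ hρ => ?_⟩
  have := hρ.isProb
  refine measure_eq_of_discrete hρ.discrete hdisc ?_
  have hρe := (isDiscreteInvariant_iff hle hρ.discrete).1 hρ
  have hpe' : p + pgf (truncLaw n d) p = 1 := hpe
  rw [hmass]
  have hmono := monotoneOn_pgf_truncLaw n d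
  rcases lt_trichotomy (ρ.real {1}) p with h | h | h
  · have := hmono (measureReal_nonneg : (0 : ℝ) ≤ ρ.real {1}) hp.1 h.le
    linarith
  · exact h
  · have := hmono hp.1 (measureReal_nonneg : (0 : ℝ) ≤ ρ.real {1}) h.le
    linarith

/-! ### Finite-depth iteration on the tree -/

/-- The value at `u` obtained by iterating the equation `m` times with family sizes `k`, starting
from the values `x` in generation `|u| + m`. -/
noncomputable def treeIter : ℕ → (Vertex → ℕ∞) → (Vertex → I) → Vertex → I
  | 0, _, x, u => x u
  | m + 1, k, x, u => σ (liveProd (k u) fun i => treeIter m k x (u ++ [i]))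

/-- Measurability is required only at the descendants of `u` that are actually visited, so that the
lemma also applies to the sigma-algebra of a subtree or of finitely many generations. -/
theorem measurable_treeIter {Ω : Type*} [MeasurableSpace Ω] {K : Vertex → Ω → ℕ∞}
    {x : Vertex → Ω → I} (m : ℕ) (u : Vertex)
    (hK : ∀ v, u <+: v → v.length < u.length + m → Measurable (K v))
    (hx : ∀ v, u <+: v → v.length = u.length + m → Measurable (x v)) :
    Measurable fun ω => treeIter m (fun v => K v ω) (fun v => x v ω) u := by
  induction m generalizing u with
  | zero => exact hx u List.prefix_rfl rfl
  | succ m ih =>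
    refine unitInterval.measurable_symm.comp (measurable_liveProd_comp
      (hK u List.prefix_rfl (by omega)) fun i => ih _ (fun v hv hl => ?_) (fun v hv hl => ?_))
    · exact hK v ((List.prefix_append u [i]).trans hv) (by simp at hl; omega)
    · exact hx v ((List.prefix_append u [i]).trans hv) (by simp at hl; omega)

theorem treeIter_congr {k k' : Vertex → ℕ∞} {x x' : Vertex → I} (m : ℕ) (u : Vertex)
    (hk : ∀ v, u <+: v → v.length < u.length + m → k v = k' v)
    (hx : ∀ v, u <+: v → v.length = u.length + m → x v = x' v) :
    treeIter m k x u = treeIter m k' x' u := by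
  induction m generalizing u with
  | zero => exact hx u List.prefix_rfl rfl
  | succ m ih =>
    simp only [treeIter]
    rw [hk u List.prefix_rfl (by omega)]
    congr 2
    ext1 i
    refine ih _ (fun v hv hl => ?_) (fun v hv hl => ?_)
    · exact hk v ((List.prefix_append u [i]).trans hv) (by simp at hl; omega)
    · exact hx v ((List.prefix_append u [i]).trans hv) (by simp at hl; omega)

theorem ae_eq_treeIter {Ω : Type*} [MeasurableSpace Ω] {P : Measure Ω} {M : Vertex → Ω → ℕ∞}
    {X : Vertex → Ω → I}
    (h : ∀ u, ∀ᵐ ω ∂P, X u ω = σ (liveProd (M u ω) (fun i => X (u ++ [i]) ω))) (m : ℕ)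
    (u : Vertex) : ∀ᵐ ω ∂P, X u ω = treeIter m (fun v => M v ω) (fun v => X v ω) u := by
  induction m generalizing u with
  | zero => exact ae_of_all _ fun _ => rfl
  | succ m ih =>
    filter_upwards [h u, ae_all_iff.2 fun i => ih (u ++ [i])] with ω h1 h2
    rw [h1]
    simp only [treeIter, h2]

theorem disjoint_subtrees (u : Vertex) :
    Pairwise fun i j : ℕ => Disjoint {v : Vertex | u ++ [i] <+: v} {v | u ++ [j] <+: v} := by
  intro i j hij
  rw [Set.disjoint_left]
  intro v hi hj
  have h := List.prefix_of_prefix_length_le hi hj (by simp)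
  have := h.eq_of_length (by simp)
  simp at this
  exact hij this

theorem iIndepFun_of_measurable_iSup {Ω ι κ : Type*} {mΩ : MeasurableSpace Ω} {P : Measure Ω}
    {m : ι → MeasurableSpace Ω} (hle : ∀ i, m i ≤ mΩ) (h : iIndep m P) {S : κ → Set ι}
    (hS : Pairwise fun a b => Disjoint (S a) (S b)) {β : Type*} [MeasurableSpace β]
    {Z : κ → Ω → β} (hZ : ∀ a, Measurable[⨆ i ∈ S a, m i] (Z a)) : iIndepFun Z P := by
  rw [iIndepFun_iff_iIndep]
  exact iIndep_of_iIndep_of_le (iIndep_iSup_of_disjoint hle h hS) fun a => (hZ a).comap_le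

/-- An extension to the whole tree of a family of values in generation `L`. -/
noncomputable def extendLevel (L : ℕ) (x : {v : Vertex // v.length = L} → I) (v : Vertex) : I :=
  if h : v.length = L then x ⟨v, h⟩ else 0

theorem measurable_extendLevel (L : ℕ) (v : Vertex) :
    Measurable fun x : {v : Vertex // v.length = L} → I => extendLevel L x v := by
  unfold extendLevel
  split_ifs <;> fun_prop

/-- For fixed family sizes, the iteration is affine in each of the boundary values, so that its mean
is the iteration started from the mean of the boundary values. -/
theorem integral_treeIter_extendLevel {Ω : Type*} [MeasurableSpace Ω] {P : Measure Ω}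
    [IsProbabilityMeasure P] {n L : ℕ} {k : Vertex → ℕ∞} (hk : ∀ v, k v ≤ n)
    {x : {v : Vertex // v.length = L} → Ω → I} (hm : ∀ v, Measurable (x v)) (hi : iIndepFun x P)
    {p : I} (hp : ∀ v, ∫ ω, (x v ω : ℝ) ∂P = p) (m : ℕ) (u : Vertex) (hu : u.length + m = L) :
    ∫ ω, (treeIter m k (extendLevel L fun v => x v ω) u : ℝ) ∂P = treeIter m k (fun _ => p) u := by
  have hmeas : ∀ m u, Measurable fun ω => treeIter m k (extendLevel L fun v => x v ω) u :=
    fun m u => measurable_treeIter (K := fun v _ => k v) m u (fun _ _ _ => measurable_const)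
      (fun v _ _ => (measurable_extendLevel L v).comp (measurable_pi_lambda _ hm))
  induction m generalizing u with
  | zero =>
    have : u.length = L := by omega
    simp [treeIter, extendLevel, this, hp]
  | succ m ih =>
    obtain ⟨j, -, hj⟩ := exists_natCast_eq_of_le (hk u)
    simp only [treeIter, hj, liveProd_natCast, unitInterval.coe_symm_eq, coe_prod_unitInterval]
    -- The values at distinct daughters depend on boundary values in disjoint subtrees.
    have hind : iIndepFun (fun i ω => treeIter m k (extendLevel L fun v => x v ω) (u ++ [i])) P := by
      refine iIndepFun_of_measurable_iSup (fun v => (hm v).comap_le) hi.iIndep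
        (S := fun i => {v | u ++ [i] <+: v.1}) (fun i j hij => ?_) fun i => ?_
      · exact (disjoint_subtrees u hij).preimage Subtype.val
      · refine @measurable_treeIter _ (_) (fun v _ => k v) _ m (u ++ [i])
          (fun _ _ _ => measurable_const) fun v hv hl => ?_
        have hvL : v.length = L := by simp at hl; omega
        simp only [extendLevel, hvL, dif_pos]
        exact (comap_measurable (x ⟨v, hvL⟩)).mono
          (le_iSup₂_of_le (f := fun v (_ : v ∈ {v : {v : Vertex // v.length = L} | u ++ [i] <+: v.1})
            => MeasurableSpace.comap (x v) inferInstance) ⟨v, hvL⟩ hv le_rfl) le_rfl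
    rw [integral_sub (integrable_const _), integral_prod_of_iIndepFun
      (Z := fun i ω => (treeIter m k (extendLevel L fun v => x v ω) (u ++ [i]) : ℝ))
      (hind.comp (fun _ => Subtype.val) fun _ => measurable_subtype_coe)
      (fun i => (hmeas m _).subtype_val)]
    · simp only [integral_const, probReal_univ, smul_eq_mul, mul_one]
      congr 1
      exact Finset.prod_congr rfl fun i _ => ih _ (by simp; omega)
    · simp only [← coe_prod_unitInterval]
      exact integrable_coe_unitInterval (Finset.measurable_fun_prod _ fun i _ => hmeas m _)

/-- The first two moments of the iteration started from a constant fixed point. -/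
theorem moments_treeIter {Ω : Type*} [MeasurableSpace Ω] {P : Measure Ω} [IsProbabilityMeasure P]
    {n : ℕ} {M : Vertex → Ω → ℕ∞} (hM : ∀ v, Measurable (M v)) (hMn : ∀ v ω, M v ω ≤ n)
    (hi : iIndepFun M P) {D : Measure ℕ∞} (hlaw : ∀ v, P.map (M v) = D) {p : I}
    (hp : (p : ℝ) + pgf D p = 1) (m : ℕ) (u : Vertex) :
    ∫ ω, (treeIter m (fun v => M v ω) (fun _ => p) u : ℝ) ∂P = p ∧
    ∫ ω, (treeIter m (fun v => M v ω) (fun _ => p) u : ℝ) ^ 2 ∂P =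
      secondMoment (pgf D) p m := by
  have hmeas : ∀ m u, Measurable fun ω => treeIter m (fun v => M v ω) (fun _ => p) u :=
    fun m u => measurable_treeIter m u (fun v _ _ => hM v) (fun _ _ _ => measurable_const)
  have hD : ∀ᵐ k ∂D, k ≤ (n : ℕ∞) := by
    rw [← hlaw [], ae_map_iff (hM []).aemeasurable (Set.to_countable _).measurableSet]
    exact ae_of_all _ (hMn [])
  induction m generalizing u with
  | zero => simp [treeIter, secondMoment]
  | succ m ih =>
    have hsub : ∀ i, Measurable[⨆ v ∈ {v | u ++ [i] <+: v}, MeasurableSpace.comap (M v) inferInstance]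
        fun ω => treeIter m (fun v => M v ω) (fun _ => p) (u ++ [i]) := by
      intro i
      refine @measurable_treeIter _ (_) M (fun _ _ => p) m (u ++ [i]) (fun v hv _ => ?_)
        (fun _ _ _ => measurable_const)
      exact (comap_measurable (M v)).mono
        (le_iSup₂_of_le (f := fun v (_ : v ∈ {v : Vertex | u ++ [i] <+: v})
            => MeasurableSpace.comap (M v) inferInstance) v hv le_rfl) le_rfl
    have hle : ∀ v, MeasurableSpace.comap (M v) inferInstance ≤ ‹MeasurableSpace Ω› :=
      fun v => (hM v).comap_le
    have hind : iIndepFun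
        (fun i ω => treeIter m (fun v => M v ω) (fun _ => p) (u ++ [i])) P :=
      iIndepFun_of_measurable_iSup hle hi.iIndep (disjoint_subtrees u) hsub
    -- The daughters' values use only family sizes strictly below `u`.
    have hindK : IndepFun (M u)
        (fun ω i => treeIter m (fun v => M v ω) (fun _ => p) (u ++ [i])) P := by
      rw [IndepFun_iff_Indep]
      have hdisj : Disjoint ({u} : Set Vertex) (⋃ i, {v | u ++ [i] <+: v}) := by
        rw [Set.disjoint_singleton_left, Set.mem_iUnion]
        rintro ⟨i, hv⟩
        have := List.IsPrefix.length_le hv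
        simp at this
      refine indep_of_indep_of_le_left (indep_of_indep_of_le_right
        (indep_iSup_of_disjoint hle hi.iIndep hdisj) ?_) ?_
      · refine Measurable.comap_le (@measurable_pi_lambda _ _ _ (_) _ _ fun i => ?_)
        exact (hsub i).mono (biSup_mono fun v hv => Set.mem_iUnion.2 ⟨i, hv⟩) le_rfl
      · simp
    have h1 := integral_liveProd (n := n) (hM u) (ae_of_all _ (hMn u)) (fun i => hmeas m _) hind
      hindK (fun i => (ih (u ++ [i])).1)
    have hsq : ∀ i, Measurable fun ω => treeIter m (fun v => M v ω) (fun _ => p) (u ++ [i]) *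
        treeIter m (fun v => M v ω) (fun _ => p) (u ++ [i]) := fun i => (hmeas m _).mul (hmeas m _)
    have hmul : Measurable fun x : I => x * x := measurable_id.mul measurable_id
    -- The squared daughter values are again i.i.d. and independent of `M u`, now with mean
    -- `secondMoment (pgf D) p m`.
    have h2 := integral_liveProd (n := n) (hM u) (ae_of_all _ (hMn u)) hsq
      (hind.comp (fun _ x => x * x) fun _ => hmul)
      (hindK.comp (φ := id) (ψ := fun (y : ℕ → I) i => y i * y i) measurable_id
        (measurable_pi_lambda _ fun i => hmul.comp (measurable_pi_apply i)))
      (z := secondMoment (pgf D) p m)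
      (fun i => by rw [← (ih (u ++ [i])).2]; simp [sq])
    rw [hlaw, ← pgf_eq_sum hD] at h1 h2
    have i1 := integrable_coe_unitInterval (P := P)
      (measurable_liveProd_comp (hM u) fun i => hmeas m (u ++ [i]))
    have i2 := integrable_coe_unitInterval (P := P) (measurable_liveProd_comp (hM u) hsq)
    constructor
    · simp only [treeIter, unitInterval.coe_symm_eq]
      rw [integral_sub (integrable_const _) i1, h1]
      simp
      linarith
    -- Expand `(1 - Π) ^ 2`; the square of the product is the product of the squares.
    · have e : ∀ ω, (treeIter (m + 1) (fun v => M v ω) (fun _ => p) u : ℝ) ^ 2 =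
          1 - 2 * (liveProd (M u ω)
            fun i => treeIter m (fun v => M v ω) (fun _ => p) (u ++ [i]) : I) +
          (liveProd (M u ω) fun i => treeIter m (fun v => M v ω) (fun _ => p) (u ++ [i]) *
            treeIter m (fun v => M v ω) (fun _ => p) (u ++ [i]) : I) := by
        intro ω
        rw [← liveProd_mul (hMn u ω)]
        simp only [treeIter, unitInterval.coe_symm_eq, Set.Icc.coe_mul]
        ring
      simp only [e]
      have i3 : Integrable (fun ω => 1 - 2 * ((liveProd (M u ω)
          fun i => treeIter m (fun v => M v ω) (fun _ => p) (u ++ [i]) : I) : ℝ)) P :=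
        (integrable_const (1 : ℝ) (μ := P)).sub (i1.const_mul 2)
      rw [integral_add i3 i2, integral_sub (integrable_const _) (i1.const_mul 2),
        integral_const_mul, h1, h2]
      simp [secondMoment]
      linarith

/-! ### Conditioning on the family sizes -/

section Levels

variable {Ω : Type*} {M : Vertex → Ω → ℕ∞}

/-- The sigma-algebra of the family sizes in the first `L` generations. -/
abbrev noiseAlgebra (M : Vertex → Ω → ℕ∞) (L : ℕ) : MeasurableSpace Ω :=
  MeasurableSpace.comap (fun ω (v : {v : Vertex // v.length < L}) => M v ω) inferInstance

theorem comap_le_noiseAlgebra {L : ℕ} {v : Vertex} (hv : v.length < L) :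
    MeasurableSpace.comap (M v) inferInstance ≤ noiseAlgebra M L := by
  refine Measurable.comap_le ?_
  exact (measurable_pi_apply (⟨v, hv⟩ : {v : Vertex // v.length < L})).comp
    (comap_measurable (fun ω (v : {v : Vertex // v.length < L}) => M v ω))

theorem noiseAlgebra_le_iff {L : ℕ} {m : MeasurableSpace Ω} :
    noiseAlgebra M L ≤ m ↔
      ∀ v : Vertex, v.length < L → MeasurableSpace.comap (M v) inferInstance ≤ m := by
  refine ⟨fun h v hv => (comap_le_noiseAlgebra hv).trans h, fun h => Measurable.comap_le ?_⟩
  exact measurable_pi_lambda _ fun v => measurable_iff_comap_le.2 (h v v.2)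

theorem measurable_noiseAlgebra_treeIter (p : I) (m : ℕ) (u : Vertex) :
    Measurable[noiseAlgebra M (u.length + m)]
      fun ω => treeIter m (fun v => M v ω) (fun _ => p) u :=
  @measurable_treeIter _ (_) M (fun _ _ => p) m u
    (fun _ _ hl => measurable_iff_comap_le.2 (comap_le_noiseAlgebra hl))
    (fun _ _ _ => measurable_const)

variable [mΩ : MeasurableSpace Ω] {P : Measure Ω} {X : Vertex → Ω → I}

/-- The filtration of the family sizes in the first `l + m` generations. -/
def noiseFiltration (hM : ∀ v, Measurable (M v)) (l : ℕ) : Filtration ℕ mΩ where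
  seq m := noiseAlgebra M (l + m)
  mono' _ _ hab := noiseAlgebra_le_iff.2 fun _ hv => comap_le_noiseAlgebra (by omega)
  le' _ := noiseAlgebra_le_iff.2 fun v _ => (hM v).comap_le

theorem iSup_noiseFiltration (hM : ∀ v, Measurable (M v)) (l : ℕ) :
    ⨆ m, noiseFiltration hM l m = ⨆ v, MeasurableSpace.comap (M v) inferInstance := by
  refine le_antisymm (iSup_le fun m => noiseAlgebra_le_iff.2 fun v _ =>
    le_iSup (fun v => MeasurableSpace.comap (M v) inferInstance) v) (iSup_le fun v => ?_)
  exact le_iSup_of_le (v.length + 1) (comap_le_noiseAlgebra (by omega))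

/-- The conditional expectation of a tree-indexed solution given the first generations of family
sizes is the iteration started from the mean. -/
theorem condExp_treeSolution [IsProbabilityMeasure P] {n : ℕ} (hM : ∀ v, Measurable (M v))
    (hMn : ∀ v ω, M v ω ≤ n) (hX : IsTreeSolution P M X) {p : I}
    (hp : ∀ u, ∫ ω, (X u ω : ℝ) ∂P = p) (m : ℕ) (u : Vertex) :
    (fun ω => (treeIter m (fun v => M v ω) (fun _ => p) u : ℝ)) =ᵐ[P]
      P[fun ω => (X u ω : ℝ) | noiseAlgebra M (u.length + m)] := by
  set L := u.length + m with hL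
  let A : Ω → {v : Vertex // v.length < L} → ℕ∞ := fun ω v => M v ω
  let B : Ω → {v : Vertex // v.length = L} → I := fun ω v => X v ω
  have hA : Measurable A := measurable_pi_lambda _ fun v => hM v
  have hB : Measurable B := measurable_pi_lambda _ fun v => hX.measurable v
  -- Capping at `n` changes nothing along `A ω`, but gives the bound for every `a`, as the pointwise
  -- lemma `integral_treeIter_extendLevel` demands. The value `0` in later generations is never
  -- read.
  let k : ({v : Vertex // v.length < L} → ℕ∞) → Vertex → ℕ∞ := fun a v =>
    if h : v.length < L then min n (a ⟨v, h⟩) else 0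
  have hk : ∀ v, Measurable fun a => k a v := by
    intro v
    by_cases h : v.length < L
    · simp only [k, h, dif_pos]
      exact (measurable_of_countable fun j : ℕ∞ => min (n : ℕ∞) j).comp
        (measurable_pi_apply (⟨v, h⟩ : {v : Vertex // v.length < L}))
    · simp only [k, h, dif_neg, not_false_eq_true]
      exact measurable_const
  have hkn : ∀ a v, k a v ≤ n := by
    intro a v
    simp only [k]
    split_ifs
    · exact min_le_left _ _
    · exact zero_le
  have hkA : ∀ ω v, v.length < L → k (A ω) v = M v ω := by
    intro ω v hv
    simp [k, A, hv, hMn]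
  have hY : ∀ ω, treeIter m (fun v => M v ω) (fun _ => p) u =
      treeIter m (k (A ω)) (fun _ => p) u := fun ω =>
    treeIter_congr m u (fun v _ hv => (hkA ω v hv).symm) (fun _ _ _ => rfl)
  have hXe : ∀ᵐ ω ∂P, X u ω = treeIter m (k (A ω)) (extendLevel L (B ω)) u := by
    filter_upwards [ae_eq_treeIter hX.equation m u] with ω hω
    rw [hω]
    refine treeIter_congr m u (fun v _ hv => (hkA ω v hv).symm) (fun v _ hv => ?_)
    simp [extendLevel, B, hv, ← hL]
  have hle : noiseAlgebra M L ≤ mΩ := noiseAlgebra_le_iff.2 fun v _ => (hM v).comap_le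
  have hYm := (measurable_noiseAlgebra_treeIter (M := M) p m u)
  have hF : Measurable fun q : ({v : Vertex // v.length < L} → ℕ∞) ×
      ({v : Vertex // v.length = L} → I) => treeIter m (k q.1) (extendLevel L q.2) u :=
    measurable_treeIter (K := fun v (q : ({v : Vertex // v.length < L} → ℕ∞) ×
      ({v : Vertex // v.length = L} → I)) => k q.1 v) m u
      (fun v _ _ => (hk v).comp measurable_fst)
      (fun v _ _ => (measurable_extendLevel L v).comp measurable_snd)
  have hlaw : P.map (fun ω => (A ω, B ω)) = (P.map A).prod (P.map B) :=
    (indepFun_iff_map_prod_eq_prod_map_map hA.aemeasurable hB.aemeasurable).1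
      (hX.indep_noise L).symm
  -- Freezing the family sizes and averaging over the independent boundary values replaces each of
  -- these by `p`; Fubini then gives the conditional expectation.
  have hinner : ∀ a, ∫ b, (treeIter m (k a) (extendLevel L b) u : ℝ) ∂P.map B =
      treeIter m (k a) (fun _ => p) u := by
    intro a
    have hFa : Measurable fun b => (treeIter m (k a) (extendLevel L b) u : ℝ) :=
      (hF.comp (measurable_prodMk_left (x := a))).subtype_val
    rw [integral_map hB.aemeasurable hFa.aestronglyMeasurable]
    exact integral_treeIter_extendLevel (hkn a) (fun v => hX.measurable v) (hX.indep_level L)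
      (fun v => hp v) m u hL.symm
  have : IsProbabilityMeasure (P.map A) := Measure.isProbabilityMeasure_map hA.aemeasurable
  have : IsProbabilityMeasure (P.map B) := Measure.isProbabilityMeasure_map hB.aemeasurable
  have hYI := integrable_coe_unitInterval (P := P) (hYm.mono hle le_rfl)
  refine ae_eq_condExp_of_forall_setIntegral_eq hle
    (integrable_coe_unitInterval (hX.measurable u)) (fun s _ _ => hYI.integrableOn)
    (fun s hs _ => ?_) hYm.subtype_val.stronglyMeasurable.aestronglyMeasurable
  obtain ⟨C, hC, rfl⟩ := hs
  have hCA : MeasurableSet (A ⁻¹' C) := hA hC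
  have hCm : Measurable (C.indicator (fun _ => (1 : ℝ))) := measurable_const.indicator hC
  have hG : Measurable fun q : ({v : Vertex // v.length < L} → ℕ∞) ×
      ({v : Vertex // v.length = L} → I) =>
      C.indicator (fun _ => (1 : ℝ)) q.1 * (treeIter m (k q.1) (extendLevel L q.2) u : ℝ) :=
    (hCm.comp measurable_fst).mul hF.subtype_val
  have hGA : Measurable fun a => C.indicator (fun _ => (1 : ℝ)) a * (treeIter m (k a) (fun _ => p) u : ℝ) :=
    hCm.mul (measurable_treeIter (K := fun v a => k a v) (x := fun _ _ => p) m u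
      (fun v _ _ => hk v) (fun _ _ _ => measurable_const)).subtype_val
  have hGI : Integrable (fun q : ({v : Vertex // v.length < L} → ℕ∞) ×
      ({v : Vertex // v.length = L} → I) =>
      C.indicator (fun _ => (1 : ℝ)) q.1 * (treeIter m (k q.1) (extendLevel L q.2) u : ℝ))
      ((P.map A).prod (P.map B)) := by
    refine Integrable.of_bound (C := 1) hG.aestronglyMeasurable (ae_of_all _ fun q => ?_)
    by_cases hq : q.1 ∈ C <;>
      simp [hq, abs_of_nonneg (unitInterval.nonneg _), unitInterval.le_one]
  change ∫ ω in A ⁻¹' C, _ ∂P = ∫ ω in A ⁻¹' C, _ ∂P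
  rw [← integral_indicator hCA, ← integral_indicator hCA]
  have e1 : ∀ f : Ω → ℝ, (A ⁻¹' C).indicator f =
      fun ω => C.indicator (fun _ => (1 : ℝ)) (A ω) * f ω := by
    intro f
    ext ω
    by_cases h : A ω ∈ C <;> simp [h]
  rw [e1, e1]
  calc ∫ ω, C.indicator (fun _ => (1 : ℝ)) (A ω) * (treeIter m (fun v => M v ω) (fun _ => p) u : ℝ) ∂P
      = ∫ a, C.indicator (fun _ => (1 : ℝ)) a * (treeIter m (k a) (fun _ => p) u : ℝ) ∂P.map A := by
        rw [integral_map hA.aemeasurable hGA.aestronglyMeasurable]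
        simp only [hY]
    _ = ∫ q, C.indicator (fun _ => (1 : ℝ)) q.1 * (treeIter m (k q.1) (extendLevel L q.2) u : ℝ)
          ∂(P.map A).prod (P.map B) := by
        rw [integral_prod _ hGI]
        simp only [integral_const_mul, hinner]
    _ = ∫ ω, C.indicator (fun _ => (1 : ℝ)) (A ω) * (X u ω : ℝ) ∂P := by
        rw [← hlaw, integral_map (hA.prodMk hB).aemeasurable hG.aestronglyMeasurable]
        refine integral_congr_ae ?_
        filter_upwards [hXe] with ω hω
        rw [hω]

/-- The second moments of the finite-depth conditional means converge to the one of the conditional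
mean given all family sizes. -/
theorem tendsto_secondMoment_condExp [IsProbabilityMeasure P] {n : ℕ} (hM : ∀ v, Measurable (M v))
    (hMn : ∀ v ω, M v ω ≤ n) (hi : iIndepFun M P) {D : Measure ℕ∞} (hlaw : ∀ v, P.map (M v) = D)
    (hX : IsTreeSolution P M X) {p : I} (hp : ∀ u, ∫ ω, (X u ω : ℝ) ∂P = p)
    (hfix : (p : ℝ) + pgf D p = 1) (u : Vertex) :
    Tendsto (secondMoment (pgf D) p) atTop
      (𝓝 (∫ ω, (P[fun ω => (X u ω : ℝ) | ⨆ v, MeasurableSpace.comap (M v) inferInstance]) ω ^ 2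
        ∂P)) := by
  have hYm : ∀ m, Measurable fun ω => treeIter m (fun v => M v ω) (fun _ => p) u := fun m =>
    (measurable_noiseAlgebra_treeIter p m u).mono ((noiseFiltration hM u.length).le m) le_rfl
  have hae : ∀ᵐ ω ∂P, ∀ m, (treeIter m (fun v => M v ω) (fun _ => p) u : ℝ) =
      (P[fun ω => (X u ω : ℝ) | noiseFiltration hM u.length m]) ω :=
    ae_all_iff.2 fun m => condExp_treeSolution hM hMn hX hp m u
  -- Lévy's upward theorem; the squares then converge in mean by domination by `1`.
  have hlevy := tendsto_ae_condExp (μ := P) (ℱ := noiseFiltration hM u.length)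
    (fun ω => (X u ω : ℝ))
  rw [iSup_noiseFiltration] at hlevy
  have hlim := tendsto_integral_of_dominated_convergence (μ := P) (fun _ => (1 : ℝ))
    (F := fun m ω => (treeIter m (fun v => M v ω) (fun _ => p) u : ℝ) ^ 2)
    (f := fun ω => (P[fun ω => (X u ω : ℝ) |
      ⨆ v, MeasurableSpace.comap (M v) inferInstance]) ω ^ 2)
    (fun m => ((hYm m).subtype_val.pow_const 2).aestronglyMeasurable) (integrable_const _)
    (fun m => ae_of_all _ fun ω => ?_) ?_
  · simpa only [fun m => (moments_treeIter hM hMn hi hlaw hfix m u).2] using hlim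
  · rw [Real.norm_of_nonneg (sq_nonneg _)]
    exact pow_le_one₀ (unitInterval.nonneg _) (unitInterval.le_one _)
  · filter_upwards [hae, hlevy] with ω h1 h2
    simp only [h1]
    exact h2.pow 2

end Levels

/-! ### From equality of second moments to endogeny -/

/-- A variable whose square has the same mean as the square of its conditional expectation is
measurable up to null sets. -/
theorem ae_eq_condExp_of_integral_sq_eq {Ω : Type*} {m mΩ : MeasurableSpace Ω} {P : Measure Ω}
    [IsProbabilityMeasure P] (hm : m ≤ mΩ) {Z : Ω → I} (hZ : Measurable Z)
    (h : ∫ ω, (P[fun ω => (Z ω : ℝ) | m]) ω ^ 2 ∂P = ∫ ω, (Z ω : ℝ) ^ 2 ∂P) :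
    (fun ω => (Z ω : ℝ)) =ᵐ[P] P[fun ω => (Z ω : ℝ) | m] := by
  set C := P[fun ω => (Z ω : ℝ) | m] with hC
  have hZi := integrable_coe_unitInterval (P := P) hZ
  have hCm : StronglyMeasurable[m] C := stronglyMeasurable_condExp
  have hCm' : StronglyMeasurable C := hCm.mono hm
  have hbd : ∀ᵐ ω ∂P, ‖C ω‖ ≤ 1 := by
    have := ae_bdd_abs_condExp_of_ae_bdd_abs (m := m) (μ := P) (R := 1) (f := fun ω => (Z ω : ℝ))
      (ae_of_all _ fun ω => by
        simpa [abs_of_nonneg (unitInterval.nonneg _)] using unitInterval.le_one _)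
    simpa using this
  have hCi : Integrable C P := integrable_condExp
  have hCsq : Integrable (fun ω => C ω ^ 2) P := by
    refine Integrable.of_bound (C := 1) (hCm'.pow 2).aestronglyMeasurable ?_
    filter_upwards [hbd] with ω hω
    rw [norm_pow]
    exact pow_le_one₀ (norm_nonneg _) hω
  have hZsq : Integrable (fun ω => (Z ω : ℝ) ^ 2) P := by
    simpa [sq] using integrable_coe_unitInterval (P := P) (hZ.mul hZ)
  have hZC : Integrable (fun ω => (Z ω : ℝ) * C ω) P := by
    refine hZi.mul_bdd (c := 1) hCm'.aestronglyMeasurable hbd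
  have hpull : ∫ ω, (Z ω : ℝ) * C ω ∂P = ∫ ω, C ω ^ 2 ∂P := by
    rw [← integral_condExp hm]
    refine integral_congr_ae ?_
    filter_upwards [condExp_mul_of_stronglyMeasurable_right hCm hZC hZi] with ω hω
    rw [sq]
    exact hω
  -- Pythagoras: since `E[Z C] = E[C ^ 2]`, the squared distance is `E[Z ^ 2] - E[C ^ 2]`.
  have hzero : ∫ ω, ((Z ω : ℝ) - C ω) ^ 2 ∂P = 0 := by
    have e : ∀ ω, ((Z ω : ℝ) - C ω) ^ 2 = (Z ω : ℝ) ^ 2 - 2 * ((Z ω : ℝ) * C ω) + C ω ^ 2 :=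
      fun ω => by ring
    have i1 : Integrable (fun ω => (Z ω : ℝ) ^ 2 - 2 * ((Z ω : ℝ) * C ω)) P :=
      hZsq.sub (hZC.const_mul 2)
    simp only [e]
    rw [integral_add i1 hCsq, integral_sub hZsq (hZC.const_mul 2), integral_const_mul, hpull, h]
    ring
  have hi : Integrable (fun ω => ((Z ω : ℝ) - C ω) ^ 2) P := by
    have e : (fun ω => ((Z ω : ℝ) - C ω) ^ 2) =
      fun ω => (Z ω : ℝ) ^ 2 - 2 * ((Z ω : ℝ) * C ω) + C ω ^ 2 := by ext ω; ring
    rw [e]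
    exact (hZsq.sub (hZC.const_mul 2)).add hCsq
  have := (integral_eq_zero_iff_of_nonneg (fun ω => sq_nonneg _) hi).1 hzero
  filter_upwards [this] with ω hω
  have : (Z ω : ℝ) - C ω = 0 := by simpa using hω
  linarith

end VetoVoter

theorem theorem4p9 (d : MeasureTheory.Measure ℕ∞) [MeasureTheory.IsProbabilityMeasure d]
    (hd_zero : VetoVoter.pgf d 0 = 0)
    (hd_convex : StrictConvexOn ℝ (Set.Ico (0 : ℝ) 1) (VetoVoter.pgf d))
    (n : ℕ) (hn : 2 ≤ n) :
    (∃! ν : MeasureTheory.Measure unitInterval,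
      VetoVoter.IsDiscreteInvariant (VetoVoter.truncLaw n d) ν) ∧
    ∀ ν : MeasureTheory.Measure unitInterval,
      VetoVoter.IsDiscreteInvariant (VetoVoter.truncLaw n d) ν →
      ∀ {Ω : Type*} [MeasurableSpace Ω] (P : MeasureTheory.Measure Ω)
        [MeasureTheory.IsProbabilityMeasure P]
        (N : VetoVoter.Vertex → Ω → ℕ∞) (X : VetoVoter.Vertex → Ω → unitInterval),
        VetoVoter.IsNoise P d N →
        VetoVoter.IsTreeSolution P (fun u ω => min (n : ℕ∞) (N u ω)) X →
        P.map (X []) = ν →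
        (VetoVoter.IsEndogenous P (fun u ω => min (n : ℕ∞) (N u ω)) X ↔
          deriv (VetoVoter.pgf (VetoVoter.truncLaw n d)) (ν.real {1}) ≤ 1) := by
  open VetoVoter in
  refine ⟨existsUnique_isDiscreteInvariant hd_zero (by omega), ?_⟩
  intro ν hν Ω mΩ P _ N X hN hX hroot
  have hprob := hν.isProb
  have hfix := (isDiscreteInvariant_iff (ae_truncLaw_le n d) hν.discrete).1 hν
  have hmin : Measurable fun j : ℕ∞ => min (n : ℕ∞) j := measurable_of_countable _
  set M : Vertex → Ω → ℕ∞ := fun u ω => min (n : ℕ∞) (N u ω)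
  have hM : ∀ v, Measurable (M v) := fun v => hmin.comp (hN.measurable v)
  have hMn : ∀ v ω, M v ω ≤ n := fun v ω => min_le_left _ _
  have hi : iIndepFun M P := hN.indep.comp (fun _ j => min (n : ℕ∞) j) fun _ => hmin
  have hlaw : ∀ v, P.map (M v) = truncLaw n d := fun v => by
    rw [truncLaw, ← hN.law v, Measure.map_map hmin (hN.measurable v)]
    rfl
  have hXlaw : ∀ u, P.map (X u) = ν := fun u => (hX.stationary u).trans hroot
  obtain ⟨p, hpν⟩ : ∃ p : unitInterval, (p : ℝ) = ν.real {1} :=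
    ⟨⟨ν.real {1}, measureReal_nonneg, measureReal_le_one⟩, rfl⟩
  rw [← hpν] at hfix ⊢
  have hp : ∀ u, ∫ ω, (X u ω : ℝ) ∂P = p := fun u => by
    rw [hpν, ← integral_eq_real_one hν.discrete, ← hXlaw u,
      integral_map (hX.measurable u).aemeasurable (by fun_prop)]
  have hX01 : ∀ u, ∀ᵐ ω ∂P, X u ω = 0 ∨ X u ω = 1 := fun u =>
    ae_of_ae_map (hX.measurable u).aemeasurable (by rw [hXlaw u]; exact hν.discrete)
  -- Here `X u ^ 2 = X u` almost surely, so the target second moment is the fixed point `p` itself.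
  have hsq : ∀ u, ∫ ω, (X u ω : ℝ) ^ 2 ∂P = p := fun u => by
    rw [← hp u]
    refine integral_congr_ae ?_
    filter_upwards [hX01 u] with ω hω
    rcases hω with h | h <;> simp [h]
  have hpI := mem_Ioo_of_add_pgf_eq_one hd_zero (by omega) p.2 hfix
  have hmono := monotoneOn_pgf_truncLaw n d
  have hdiff := hasDerivAt_pgf_truncLaw n d
  have hlim := tendsto_secondMoment_condExp hM hMn hi hlaw hX hp hfix
  have hle : (⨆ v, MeasurableSpace.comap (M v) inferInstance) ≤ mΩ :=
    iSup_le fun v => (hM v).comap_le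
  constructor
  · intro hE
    by_contra! hder
    obtain ⟨c, hcp, hc⟩ := exists_secondMoment_le hpI hmono (hdiff p) hfix hder fun m => by
      rw [← (moments_treeIter hM hMn hi hlaw hfix m []).2]
      exact integral_nonneg fun ω => sq_nonneg _
    -- The root alone gives the contradiction: endogeny there would force the second moments to tend
    -- to `p`, past the barrier `c < p`.
    obtain ⟨Y, hY, hXY⟩ := hE []
    have hXY' : (fun ω => (X [] ω : ℝ)) =ᵐ[P] fun ω => (Y ω : ℝ) := by
      filter_upwards [hXY] with ω hω
      rw [hω]
    have hcond : P[fun ω => (X [] ω : ℝ) | ⨆ v, MeasurableSpace.comap (M v) inferInstance]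
        =ᵐ[P] fun ω => (X [] ω : ℝ) := by
      refine (condExp_congr_ae hXY').trans (Filter.EventuallyEq.trans ?_ hXY'.symm)
      rw [condExp_of_stronglyMeasurable hle hY.subtype_val.stronglyMeasurable
        (integrable_coe_unitInterval (hY.mono hle le_rfl))]
    have hsqC := (integral_congr_ae (hcond.fun_comp (· ^ 2))).trans (hsq [])
    exact absurd (hsqC.ge.trans (le_of_tendsto' (hlim []) hc)) (not_le.2 hcp)
  · intro hder u
    have hconv := tendsto_secondMoment hpI (strictConvexOn_pgf_truncLaw hd_convex hn) hmono hdiff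
      hfix hder
    have heq := ae_eq_condExp_of_integral_sq_eq hle (hX.measurable u)
      ((tendsto_nhds_unique (hlim u) hconv).trans (hsq u).symm)
    -- The conditional expectation is real-valued; projecting it onto `[0,1]` gives an `I`-valued
    -- version without losing measurability.
    refine ⟨fun ω => Set.projIcc 0 1 zero_le_one
      ((P[fun ω => (X u ω : ℝ) | ⨆ v, MeasurableSpace.comap (M v) inferInstance]) ω), ?_, ?_⟩
    · exact continuous_projIcc.measurable.comp stronglyMeasurable_condExp.measurable
    · filter_upwards [heq] with ω hω
      rw [← hω, Set.projIcc_val]
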